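/- Let $Q$ be a real $v\times s$ matrix without zero rows whose columns are coefficient vectors of pairwise comparisons, i.e. the $k$-th column is $e_{j_k}-e_{i_k}$ with $j_k\neq i_k$, every unordered pair $\{j_k,i_k\}$ occurring at most once, and let $r=\mathrm{rank}(Q)$. Let $w=(w_1,\dots,w_v)$ be a design ($w_i\in[0,1]$, $\sum_i w_i=1$) that is feasible for $Q^T\tau$, i.e. the column space of $Q$ is contained in that of $M(w)=\mathrm{diag}(w)$ (equivalently, $w_i>0$ for all $i$). Write $\lambda_1(A)\ge\lambda_2(A)\ge\cdots$ for the eigenvalues of a symmetric matrix $A$. Put $V_Q(w)=Q^TM(w)^{-1}Q$, and let $C_Q(w)$ be the information matrix: $V_Q(w)^{-1}$ if $r=s$, and the Moore–Penrose inverse $V_Q(w)^+$ otherwise. Let $$\Psi_0(w)=\prod_{j=1}^r\lambda_j(V_Q(w)),\qquad \Phi_0(w)=\Big(\prod_{j=1}^r\lambda_j(C_Q(w))\Big)^{1/r}$$ (the products are those of the positive eigenvalues). Let $G$ be the directed graph on $\{1,\dots,v\}$ with an edge from $j$ to $i$ if and only if $e_j-e_i$ is a column of $Q$, with vertex weights $\alpha_i=1/w_i$.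 For a set $S$ of $k$ vertices and a set $X$ of $v-k$ edges of $G$ such that, disregarding orientations, $(V(G),X)$ has no cycle and each of its components contains exactly one vertex of $S$, let $X_S$ be the rooted directed spanning forest obtained by orienting all edges of $X$ towards $S$, and let its weight be $\omega(X_S)=\prod_{(i,j)\in E(X_S)}\alpha_i$, where $(i,j)$ denotes an edge directed from $i$ to $j$. Let $\kappa_k(G)$ be the sum of $\omega(X_S)$ over all such pairs $(S,X)$ with $|S|=k$. Then $\kappa_{v-r}(G)>0$, $$\Psi_0(w)=\kappa_{v-r}(G),\qquad \prod_{j=1}^r\lambda_j(C_Q(w))=\frac1{\kappa_{v-r}(G)},\qquad \Phi_0(w)=\Big(\frac1{\kappa_{v-r}(G)}\Big)^{1/r}.$$ -/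

import Mathlib

open scoped Matrix

namespace TreatmentDesign

/-! ### Moore-Penrose inverse of a real matrix -/

/-- `B` is a Moore-Penrose inverse of `A`: the four Penrose conditions. -/
structure IsMoorePenrose {m n : Type*} [Fintype m] [Fintype n]
    (A : Matrix m n ℝ) (B : Matrix n m ℝ) : Prop where
  mul_mul_left : A * B * A = A
  mul_mul_right : B * A * B = B
  herm_left : (A * B).IsHermitian
  herm_right : (B * A).IsHermitian

theorem IsMoorePenrose.unique {m n : Type*} [Fintype m] [Fintype n]
    {A : Matrix m n ℝ} {B C : Matrix n m ℝ}
    (hB : IsMoorePenrose A B) (hC : IsMoorePenrose A C) : B = C := by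
  have e1 : A * B = A * C := by
    calc A * B = (A * B)ᴴ := hB.herm_left.eq.symm
      _ = (A * C * (A * B))ᴴ := by rw [← Matrix.mul_assoc, hC.mul_mul_left]
      _ = (A * B) * (A * C) := by
        rw [Matrix.conjTranspose_mul, hB.herm_left.eq, hC.herm_left.eq]
      _ = A * C := by rw [← Matrix.mul_assoc, hB.mul_mul_left]
  have e2 : B * A = C * A := by
    calc B * A = (B * A)ᴴ := hB.herm_right.eq.symm
      _ = ((B * A) * (C * A))ᴴ := by
        rw [Matrix.mul_assoc B A (C * A), ← Matrix.mul_assoc A C A, hC.mul_mul_left]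
      _ = (C * A) * (B * A) := by
        rw [Matrix.conjTranspose_mul, hB.herm_right.eq, hC.herm_right.eq]
      _ = C * A := by
        rw [Matrix.mul_assoc C A (B * A), ← Matrix.mul_assoc A B A, hB.mul_mul_left]
  calc B = B * A * B := hB.mul_mul_right.symm
    _ = C * (A * B) := by rw [e2, Matrix.mul_assoc]
    _ = C := by rw [e1, ← Matrix.mul_assoc, hC.mul_mul_right]

theorem IsMoorePenrose.conjTranspose {m n : Type*} [Fintype m] [Fintype n]
    {A : Matrix m n ℝ} {B : Matrix n m ℝ} (h : IsMoorePenrose A B) :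
    IsMoorePenrose Aᴴ Bᴴ where
  mul_mul_left := by
    rw [← Matrix.conjTranspose_mul, ← Matrix.conjTranspose_mul, ← Matrix.mul_assoc,
      h.mul_mul_left]
  mul_mul_right := by
    rw [← Matrix.conjTranspose_mul, ← Matrix.conjTranspose_mul, ← Matrix.mul_assoc,
      h.mul_mul_right]
  herm_left := by
    rw [← Matrix.conjTranspose_mul]; exact h.herm_right.conjTranspose
  herm_right := by
    rw [← Matrix.conjTranspose_mul]; exact h.herm_left.conjTranspose

theorem exists_isMoorePenrose {n : Type*} [Fintype n] [DecidableEq n]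
    {A : Matrix n n ℝ} (hA : A.IsHermitian) : ∃ B, IsMoorePenrose A B := by
  obtain ⟨U, d, hU, hA'⟩ : ∃ (U : Matrix n n ℝ) (d : n → ℝ), Uᴴ * U = 1 ∧
      A = U * Matrix.diagonal d * Uᴴ := by
    refine ⟨hA.eigenvectorUnitary, hA.eigenvalues, ?_, ?_⟩
    · exact Unitary.coe_star_mul_self hA.eigenvectorUnitary
    · have := hA.spectral_theorem
      rw [Unitary.conjStarAlgAut_apply] at this
      exact this
  have key : ∀ a b : n → ℝ, (U * Matrix.diagonal a * Uᴴ) * (U * Matrix.diagonal b * Uᴴ)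
      = U * Matrix.diagonal (fun i => a i * b i) * Uᴴ := by
    intro a b
    calc _ = U * Matrix.diagonal a * (Uᴴ * U) * Matrix.diagonal b * Uᴴ := by
          simp only [Matrix.mul_assoc]
      _ = _ := by
          rw [hU, Matrix.mul_one, Matrix.mul_assoc U, Matrix.diagonal_mul_diagonal]
  have herm : ∀ a : n → ℝ, (U * Matrix.diagonal a * Uᴴ).IsHermitian := by
    intro a
    exact Matrix.isHermitian_mul_mul_conjTranspose U (Matrix.isHermitian_diagonal a)
  refine ⟨U * Matrix.diagonal (fun i => (d i)⁻¹) * Uᴴ, ?_, ?_, ?_, ?_⟩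
  · rw [hA', key, key]; simp
  · rw [hA', key, key]
    congr 3; ext i
    by_cases h : d i = 0 <;> simp [h]
  · rw [hA', key]; exact herm _
  · rw [hA', key]; exact herm _

open Classical in
/-- The Moore-Penrose inverse `A⁺`: the unique matrix satisfying the Penrose conditions (it is only
applied to symmetric matrices, for which existence is proved above). -/
noncomputable def pinv {m n : Type*} [Fintype m] [Fintype n] (A : Matrix m n ℝ) : Matrix n m ℝ :=
  if h : ∃ B, IsMoorePenrose A B then h.choose else 0

theorem pinv_spec {n : Type*} [Fintype n] [DecidableEq n] {A : Matrix n n ℝ}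
    (hA : A.IsHermitian) : IsMoorePenrose A (pinv A) := by
  unfold pinv
  rw [dif_pos (exists_isMoorePenrose hA)]
  exact (exists_isMoorePenrose hA).choose_spec

theorem pinv_isHermitian {n : Type*} [Fintype n] [DecidableEq n] {A : Matrix n n ℝ}
    (hA : A.IsHermitian) : (pinv A).IsHermitian := by
  have h := (pinv_spec hA).conjTranspose
  rw [hA.eq] at h
  exact h.unique (pinv_spec hA)

/-! ### Designs, information matrices, optimality criteria -/

/-- An (approximate) design on `v` treatments: treatment proportions in `[0,1]` with sum `1`. -/
def IsDesign {v : ℕ} (w : Fin v → ℝ) : Prop :=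
  (∀ i, w i ∈ Set.Icc (0 : ℝ) 1) ∧ ∑ i, w i = 1

/-- The moment matrix `M(w) = diag(w)`. -/
def momentMatrix {v : ℕ} (w : Fin v → ℝ) : Matrix (Fin v) (Fin v) ℝ := Matrix.diagonal w

/-- `w` is feasible for `Qᵀτ`: the column space of `Q` is contained in that of `M(w)`. -/
def IsFeasible {v s : ℕ} (Q : Matrix (Fin v) (Fin s) ℝ) (w : Fin v → ℝ) : Prop :=
  LinearMap.range Q.mulVecLin ≤ LinearMap.range (momentMatrix w).mulVecLin

/-- `V_Q(w) = Qᵀ M(w)⁻¹ Q`. -/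
noncomputable def varianceMatrix {v s : ℕ} (Q : Matrix (Fin v) (Fin s) ℝ) (w : Fin v → ℝ) :
    Matrix (Fin s) (Fin s) ℝ :=
  Qᵀ * (momentMatrix w)⁻¹ * Q

theorem varianceMatrix_isHermitian {v s : ℕ} (Q : Matrix (Fin v) (Fin s) ℝ) (w : Fin v → ℝ) :
    (varianceMatrix Q w).IsHermitian := by
  have h : (momentMatrix w).IsHermitian := Matrix.isHermitian_diagonal w
  have := Matrix.isHermitian_conjTranspose_mul_mul Q h.inv
  rwa [Matrix.conjTranspose_eq_transpose_of_trivial] at this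

/-- The information matrix for `Qᵀτ`: `N_Q(w) = V_Q(w)⁻¹` if the system has full rank
(`rank Q = s`), and its analogue `C_Q(w) = V_Q(w)⁺` if it is rank deficient. -/
noncomputable def informationMatrix {v s : ℕ} (Q : Matrix (Fin v) (Fin s) ℝ) (w : Fin v → ℝ) :
    Matrix (Fin s) (Fin s) ℝ :=
  if Q.rank = s then (varianceMatrix Q w)⁻¹ else pinv (varianceMatrix Q w)

theorem informationMatrix_isHermitian {v s : ℕ} (Q : Matrix (Fin v) (Fin s) ℝ) (w : Fin v → ℝ) :
    (informationMatrix Q w).IsHermitian := by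
  unfold informationMatrix
  split_ifs
  · exact (varianceMatrix_isHermitian Q w).inv
  · exact pinv_isHermitian (varianceMatrix_isHermitian Q w)

/-- `λ₁(A) ⋯ λ_r(A)`, where `λ₁(A) ≥ λ₂(A) ≥ ⋯` are the eigenvalues of the symmetric matrix `A`,
counted with multiplicity. -/
noncomputable def eigenvalueProd {s : ℕ} (A : Matrix (Fin s) (Fin s) ℝ) (hA : A.IsHermitian)
    (r : ℕ) : ℝ :=
  ∏ j : Fin (Fintype.card (Fin s)) with j.val < r, hA.eigenvalues₀ j

/-- `Ψ₀(w) = λ₁(V_Q(w)) ⋯ λ_r(V_Q(w))` with `r = rank Q`. -/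
noncomputable def psiZero {v s : ℕ} (Q : Matrix (Fin v) (Fin s) ℝ) (w : Fin v → ℝ) : ℝ :=
  eigenvalueProd (varianceMatrix Q w) (varianceMatrix_isHermitian Q w) Q.rank

/-- Product of the `r = rank Q` largest eigenvalues of the information matrix. -/
noncomputable def informationProd {v s : ℕ} (Q : Matrix (Fin v) (Fin s) ℝ) (w : Fin v → ℝ) : ℝ :=
  eigenvalueProd (informationMatrix Q w) (informationMatrix_isHermitian Q w) Q.rank

/-- Kiefer's criterion of `D`-optimality `Φ₀(w)`: the geometric mean of the `r = rank Q` largest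
eigenvalues of the information matrix (`r = s` in the full-rank case). -/
noncomputable def phiZero {v s : ℕ} (Q : Matrix (Fin v) (Fin s) ℝ) (w : Fin v → ℝ) : ℝ :=
  informationProd Q w ^ (1 / (Q.rank : ℝ))

/-! ### Pairwise comparisons and their graph -/

/-- The coefficient vector of the comparison `τ_j - τ_i`. -/
def comparison {v : ℕ} (j i : Fin v) : Fin v → ℝ := Pi.single j 1 - Pi.single i 1

/-- `Qᵀτ` is a system of pairwise comparisons: each column of `Q` is the coefficient vector of some
`τ_j - τ_i` with `j ≠ i`, and each pair of treatments is compared at most once, so that the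
corresponding graph has neither loops nor multiple edges. -/
def IsPairwiseComparisons {v s : ℕ} (Q : Matrix (Fin v) (Fin s) ℝ) : Prop :=
  (∀ k, ∃ j i, j ≠ i ∧ Q.col k = comparison j i) ∧
  ∀ k l, k ≠ l → Q.col k ≠ Q.col l ∧ Q.col k ≠ - Q.col l

/-- The directed graph of the system: an edge from `j` to `i` iff `τ_j - τ_i` is in `Qᵀτ`. -/
def contrastGraph {v s : ℕ} (Q : Matrix (Fin v) (Fin s) ℝ) : Digraph (Fin v) where
  Adj j i := ∃ k, Q.col k = comparison j i

/-! ### Rooted directed spanning forests -/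

section Forests

variable {V : Type*} [Fintype V] [DecidableEq V]

/-- The spanning subgraph `(V, X)`. -/
def edgeSubgraph (X : Finset (Sym2 V)) : SimpleGraph V := SimpleGraph.fromEdgeSet (X : Set (Sym2 V))

open Classical in
/-- The edge sets `X` of the spanning forests of `G` induced by the root set `S`: `X` consists of
`|V| - |S|` edges of `G` (regardless of their orientation), `(V, X)` has no cycle, and each of its
components contains exactly one vertex of `S`. -/
noncomputable def forestsWithRoots (G : Digraph V) (S : Finset V) : Finset (Finset (Sym2 V)) :=
  (Finset.powersetCard (Fintype.card V - S.card)
      (G.toSimpleGraphInclusive.edgeFinset)).filter fun X =>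
    (edgeSubgraph X).IsAcyclic ∧
      ∀ c : (edgeSubgraph X).ConnectedComponent, ∃! u, u ∈ S ∧ u ∈ c.supp

open Classical in
/-- The arcs of the rooted forest `X_S`: each edge of `X` is oriented towards the root of its
component, i.e. from its end `i` farther from the root to its end `j` closer to the root. -/
noncomputable def rootedArcs (X : Finset (Sym2 V)) (S : Finset V) : Finset (V × V) :=
  Finset.univ.filter fun a =>
    (edgeSubgraph X).Adj a.1 a.2 ∧
      ∃ u ∈ S, (edgeSubgraph X).Reachable a.1 u ∧
        (edgeSubgraph X).dist a.2 u < (edgeSubgraph X).dist a.1 u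

/-- The weight of `X_S` for the vertex weights `α`: each arc `(i, j)`, going from `i` to `j` in the
direction of the root, contributes `α i`. -/
noncomputable def forestWeight (α : V → ℝ) (X : Finset (Sym2 V)) (S : Finset V) : ℝ :=
  ∏ a ∈ rootedArcs X S, α a.1

/-- `κ_S(G)`, the total weight of the spanning forests induced by `S`. -/
noncomputable def kappaRoots (G : Digraph V) (α : V → ℝ) (S : Finset V) : ℝ :=
  ∑ X ∈ forestsWithRoots G S, forestWeight α X S

/-- `κ_k(G)`, the total weight of the rooted directed spanning forests with `k` roots. -/
noncomputable def kappa (G : Digraph V) (α : V → ℝ) (k : ℕ) : ℝ :=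
  ∑ S ∈ Finset.powersetCard k (Finset.univ : Finset V), kappaRoots G α S

end Forests

end TreatmentDesign

/-!
Let `V_Q(w) = Qᵀ diag(α) Q` with `α = 1 / w`. It is positive semidefinite of rank `r = rank Q`, so
the product of its `r` largest eigenvalues is the product of the nonzero ones. This equals the
`r`-th elementary symmetric function of the eigenvalues, which is the sum of the `r × r` principal
minors (`prod_nonzero_roots_eq_sum_minors`). By the Cauchy-Binet formula (`sum_minors_gram`) this
sum is `∑ (∏ i ∈ R, α i) det(Q[R, T])²` over row sets `R` and column sets `T` of size `r`. The
Cauchy-Binet formula itself follows from `det (1 + X A B) = det (1 + X B A)` by comparing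
coefficients.

Now `Q` is the incidence matrix of an oriented graph. Put `S = Rᶜ`, and let `X` be the set of edges
belonging to `T`. The minor `Q[R, T]` is `±1` if every component of `(V, X)` meets `S`, and `0`
otherwise (`minor_sq_eq_one`, `minor_sq_eq_zero`). Since `|X| = |V| - |S|`, the former happens
exactly if `X` is a forest with one vertex of `S` in each component (`covers_iff_forest`), and then
every vertex outside `S` is the tail of exactly one arc, so the weight of the rooted forest is
`∏ i ∈ R, α i` (`Covers.forestWeight_eq`). Hence `Ψ₀(w) = κ_{v-r}(G)`, and positivity of `κ_{v-r}(G)`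
is inherited from `Ψ₀(w)`.

Finally, the information matrix is in all cases the Moore-Penrose inverse of `V_Q(w)`, so its nonzero
eigenvalues are the inverses of those of `V_Q(w)` (`IsMoorePenrose.roots_charpoly`).
-/

namespace TreatmentDesign

/-! ### Principal minors and the Cauchy-Binet formula -/

open Polynomial in
/-- `A * B` and `B * A` have the same sum of `k × k` principal minors, because both sums are the
coefficient of `X ^ k` in `det (1 + X A B) = det (1 + X B A)`. -/
theorem sum_minors_mul_comm {m n R : Type*} [Fintype m] [Fintype n] [DecidableEq m]
    [DecidableEq n] [CommRing R] (A : Matrix m n R) (B : Matrix n m R) (k : ℕ) :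
    ∑ s ∈ Finset.univ.powersetCard k,
      ((A * B).submatrix (Subtype.val : s → m) (Subtype.val : s → m)).det =
    ∑ t ∈ Finset.univ.powersetCard k,
      ((B * A).submatrix (Subtype.val : t → n) (Subtype.val : t → n)).det := by
  rw [← Matrix.coeff_det_one_add_X_smul_eq_sum_minors,
    ← Matrix.coeff_det_one_add_X_smul_eq_sum_minors]
  congr 1
  rw [Matrix.map_mul, Matrix.map_mul, ← Matrix.smul_mul, Matrix.det_one_add_mul_comm,
    Matrix.mul_smul]

/-- The Cauchy-Binet formula for `A * Aᵀ`. The square of a maximal minor is written as the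
determinant of a Gram matrix, so that no bijection between rows and chosen columns is needed. -/
theorem det_mul_transpose_eq_sum {m n R : Type*} [Fintype m] [Fintype n] [DecidableEq m]
    [DecidableEq n] [CommRing R] (A : Matrix m n R) :
    (A * Aᵀ).det = ∑ t ∈ Finset.univ.powersetCard (Fintype.card m),
      ((A.submatrix id (Subtype.val : t → n))ᵀ * A.submatrix id (Subtype.val : t → n)).det := by
  have h := sum_minors_mul_comm A Aᵀ (Fintype.card m)
  rw [← Finset.card_univ, Finset.powersetCard_self, Finset.sum_singleton] at h
  let e : m ≃ {x // x ∈ (Finset.univ : Finset m)} :=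
    (Equiv.subtypeUnivEquiv (fun x => Finset.mem_univ x)).symm
  rw [← Matrix.det_submatrix_equiv_self e] at h
  rw [← Finset.card_univ]
  exact h

theorem det_transpose_mul_self_eq_sq {m n R : Type*} [Fintype m] [Fintype n] [DecidableEq m]
    [DecidableEq n] [CommRing R] (A : Matrix m n R) (e : m ≃ n) :
    (Aᵀ * A).det = (A.submatrix id e).det ^ 2 := by
  rw [← Matrix.det_submatrix_equiv_self e]
  have : (Aᵀ * A).submatrix e e = (A.submatrix id e)ᵀ * A.submatrix id e := rfl
  rw [this, Matrix.det_mul, Matrix.det_transpose, sq]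

/-- The sum of the `k × k` principal minors of `Aᵀ diag(α) A`, expanded over all pairs of a row set
and a column set of size `k`. -/
theorem sum_minors_gram {m n R : Type*} [Fintype m] [Fintype n] [DecidableEq m]
    [DecidableEq n] [CommRing R] (A : Matrix m n R) (α : m → R) (k : ℕ) :
    ∑ t ∈ Finset.univ.powersetCard k,
      ((Aᵀ * Matrix.diagonal α * A).submatrix (Subtype.val : t → n) (Subtype.val : t → n)).det =
    ∑ s ∈ Finset.univ.powersetCard k, (∏ i ∈ s, α i) * ∑ t ∈ Finset.univ.powersetCard k,
      ((A.submatrix (Subtype.val : s → m) (Subtype.val : t → n))ᵀ *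
        A.submatrix (Subtype.val : s → m) (Subtype.val : t → n)).det := by
  rw [Matrix.mul_assoc, sum_minors_mul_comm]
  refine Finset.sum_congr rfl fun s hs => ?_
  have hc : Fintype.card s = k := by simpa using hs
  have h1 : (Matrix.diagonal α * A * Aᵀ).submatrix (Subtype.val : s → m) (Subtype.val : s → m) =
      Matrix.diagonal (fun i : s => α i) *
        (A.submatrix (Subtype.val : s → m) id * (A.submatrix (Subtype.val : s → m) id)ᵀ) := by
    ext i j
    rw [Matrix.mul_assoc, Matrix.submatrix_apply, Matrix.diagonal_mul, Matrix.diagonal_mul]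
    rfl
  rw [h1, Matrix.det_mul, Matrix.det_diagonal, det_mul_transpose_eq_sum, hc,
    Finset.prod_coe_sort s α]
  rfl

/-- The determinant of a matrix that is strictly triangular off the diagonal with respect to a
height function `d`, which need not be injective. -/
theorem det_eq_prod_diag_of_rank {n R : Type*} [Fintype n] [DecidableEq n] [CommRing R]
    (M : Matrix n n R) (d : n → ℕ) (h : ∀ i j, M i j ≠ 0 → i = j ∨ d i < d j) :
    M.det = ∏ i, M i i := by
  rw [Matrix.det_apply, Finset.sum_eq_single 1]
  · simp
  · intro σ _ hσ
    -- otherwise `d ∘ σ ≤ d`, and since both sides have the same sum, `σ` fixes every index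
    have : ∃ i, M (σ i) i = 0 := by
      by_contra! hne
      apply hσ
      have hle : ∀ i ∈ Finset.univ, d (σ i) ≤ d i := fun i _ => by
        rcases h _ _ (hne i) with h1 | h1
        · rw [h1]
        · exact h1.le
      have heq := (Finset.sum_eq_sum_iff_of_le hle).1 (Equiv.sum_comp σ d)
      ext i
      rcases h _ _ (hne i) with h1 | h1
      · exact h1
      · exact absurd (heq i (Finset.mem_univ i)) h1.ne
    obtain ⟨i, hi⟩ := this
    have hz : ∏ i, M (σ i) i = 0 := Finset.prod_eq_zero (Finset.mem_univ i) hi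
    exact (congrArg _ hz).trans (smul_zero _)
  · simp

/-! ### Eigenvalues and principal minors -/

open Polynomial in
/-- The eigenvalues of the Moore-Penrose inverse are the inverses of those of the matrix; the
convention `0⁻¹ = 0` makes this correct for the zero eigenvalues. -/
theorem IsMoorePenrose.roots_charpoly {n : Type*} [Fintype n] [DecidableEq n]
    {A B : Matrix n n ℝ} (hA : A.IsHermitian) (hB : IsMoorePenrose A B) :
    B.charpoly.roots = A.charpoly.roots.map (·⁻¹) := by
  obtain ⟨U, d, hU, hA', hd⟩ : ∃ (U : Matrix n n ℝ) (d : n → ℝ), Uᴴ * U = 1 ∧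
      A = U * Matrix.diagonal d * Uᴴ ∧ d = hA.eigenvalues := by
    refine ⟨hA.eigenvectorUnitary, hA.eigenvalues, ?_, ?_, rfl⟩
    · exact Unitary.coe_star_mul_self hA.eigenvectorUnitary
    · have := hA.spectral_theorem
      rw [Unitary.conjStarAlgAut_apply] at this
      exact this
  have key : ∀ a b : n → ℝ, (U * Matrix.diagonal a * Uᴴ) * (U * Matrix.diagonal b * Uᴴ)
      = U * Matrix.diagonal (fun i => a i * b i) * Uᴴ := by
    intro a b
    calc _ = U * Matrix.diagonal a * (Uᴴ * U) * Matrix.diagonal b * Uᴴ := by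
          simp only [Matrix.mul_assoc]
      _ = _ := by
          rw [hU, Matrix.mul_one, Matrix.mul_assoc U, Matrix.diagonal_mul_diagonal]
  have herm : ∀ a : n → ℝ, (U * Matrix.diagonal a * Uᴴ).IsHermitian := fun a =>
    Matrix.isHermitian_mul_mul_conjTranspose U (Matrix.isHermitian_diagonal a)
  have hC : IsMoorePenrose A (U * Matrix.diagonal (fun i => (d i)⁻¹) * Uᴴ) := by
    refine ⟨?_, ?_, ?_, ?_⟩
    · rw [hA', key, key]; simp
    · rw [hA', key, key]
      congr 3; ext i
      by_cases h : d i = 0 <;> simp [h]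
    · rw [hA', key]; exact herm _
    · rw [hA', key]; exact herm _
  have hroots : ∀ a : n → ℝ, (U * Matrix.diagonal a * Uᴴ).charpoly.roots =
      Finset.univ.val.map a := by
    intro a
    rw [Matrix.charpoly_mul_comm, ← Matrix.mul_assoc, hU, Matrix.one_mul,
      Matrix.charpoly_diagonal, Polynomial.roots_prod]
    · simp
    · simp [Finset.prod_ne_zero_iff, Polynomial.X_sub_C_ne_zero]
  rw [hB.unique hC, hroots, hA.roots_charpoly_eq_eigenvalues, Multiset.map_map, hd]
  rfl

/-- For a positive semidefinite matrix, the leading eigenvalues, as many as there are nonzero ones,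
are exactly the nonzero ones. -/
theorem eigenvalueProd_eq_prod_roots {s : ℕ} {A : Matrix (Fin s) (Fin s) ℝ} (hA : A.IsHermitian)
    (h0 : ∀ x ∈ A.charpoly.roots, 0 ≤ x) :
    eigenvalueProd A hA (A.charpoly.roots.filter (· ≠ 0)).card =
      (A.charpoly.roots.filter (· ≠ 0)).prod := by
  have hr : A.charpoly.roots = Finset.univ.val.map hA.eigenvalues₀ :=
    hA.roots_charpoly_eq_eigenvalues₀
  have hnn : ∀ j, 0 ≤ hA.eigenvalues₀ j := fun j => h0 _ (by
    rw [hr]; exact Multiset.mem_map_of_mem _ (Finset.mem_univ_val j))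
  set r := (A.charpoly.roots.filter (· ≠ 0)).card with hrdef
  have hcard : (Finset.univ.filter fun j => hA.eigenvalues₀ j ≠ 0).card = r := by
    rw [hrdef, hr, Multiset.filter_map, Multiset.card_map]; rfl
  have hset : (Finset.univ.filter fun j => hA.eigenvalues₀ j ≠ 0) =
      Finset.univ.filter fun j : Fin (Fintype.card (Fin s)) => j.val < r := by
    -- an initial segment of `Fin s` is determined by its cardinality
    have hsub : ∀ j, hA.eigenvalues₀ j ≠ 0 → j.val < r := by
      intro j hj
      have : Finset.Iic j ⊆ Finset.univ.filter fun j => hA.eigenvalues₀ j ≠ 0 := by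
        intro i hi
        have := hA.eigenvalues₀_antitone (Finset.mem_Iic.1 hi)
        have hpos := lt_of_le_of_ne (hnn j) hj.symm
        simpa using (hpos.trans_le this).ne'
      have := Finset.card_le_card this
      rw [hcard, Fin.card_Iic] at this
      omega
    refine Finset.eq_of_subset_of_card_le (fun j hj => ?_) ?_
    · simpa using hsub j (by simpa using hj)
    · rw [hcard, Fin.card_filter_val_lt]
      exact min_le_right _ _
  rw [eigenvalueProd, ← hset, hr, Multiset.filter_map]
  rfl

open Polynomial in
/-- If `r` eigenvalues are nonzero, their product is the `r`-th elementary symmetric function of all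
eigenvalues, hence up to sign a coefficient of the characteristic polynomial. -/
theorem prod_nonzero_roots_eq_sum_minors {s : ℕ} {A : Matrix (Fin s) (Fin s) ℝ}
    (hA : A.IsHermitian) {r : ℕ} (hr : (A.charpoly.roots.filter (· ≠ 0)).card = r) :
    (A.charpoly.roots.filter (· ≠ 0)).prod = ∑ t ∈ Finset.univ.powersetCard r,
      (A.submatrix (Subtype.val : t → Fin s) (Subtype.val : t → Fin s)).det := by
  have hcr : A.charpoly.roots.card = s := by
    simp [hA.roots_charpoly_eq_eigenvalues]
  have hle : r ≤ s := by
    rw [← hr]; exact (Multiset.card_le_card (Multiset.filter_le _ _)).trans_eq hcr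
  have hcz : (A.charpoly.roots.filter fun x => ¬ x ≠ 0).card = s - r := by
    have := congrArg Multiset.card (Multiset.filter_add_not (· ≠ 0) A.charpoly.roots)
    rw [Multiset.card_add, hr, hcr] at this
    omega
  have hpoly : A.charpoly = X ^ (s - r) *
      ((A.charpoly.roots.filter (· ≠ 0)).map fun a => X - C a).prod := by
    conv_lhs => rw [hA.splits_charpoly.eq_prod_roots_of_monic A.charpoly_monic]
    conv_lhs => rw [← Multiset.filter_add_not (· ≠ 0) A.charpoly.roots]
    rw [Multiset.map_add, Multiset.prod_add, mul_comm]
    congr 1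
    rw [← hcz, ← Multiset.prod_replicate, ← Multiset.map_const']
    congr 1
    refine Multiset.map_congr rfl fun x hx => ?_
    have : x = 0 := by simpa using (Multiset.mem_filter.1 hx).2
    simp [this]
  have h1 := A.charpoly_coeff_eq_sum_minors r (by simpa using hle)
  rw [Fintype.card_fin] at h1
  have h2 : A.charpoly.coeff (s - r) = (-1) ^ r * (A.charpoly.roots.filter (· ≠ 0)).prod := by
    conv_lhs => rw [hpoly]
    have := Polynomial.coeff_X_pow_mul
      (((A.charpoly.roots.filter (· ≠ 0)).map fun a => X - C a).prod) (s - r) 0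
    rw [zero_add] at this
    rw [this, Polynomial.coeff_zero_eq_eval_zero, Polynomial.eval_multiset_prod,
      Multiset.map_map, ← hr]
    generalize A.charpoly.roots.filter (· ≠ 0) = M
    induction M using Multiset.induction with
    | empty => simp
    | cons a M ih =>
      simp only [Multiset.map_cons, Multiset.prod_cons, ih, Multiset.card_cons]
      simp
      ring
  rw [h1] at h2
  exact (mul_left_cancel₀ (pow_ne_zero r (by norm_num)) h2).symm

theorem card_nonzero_roots {s : ℕ} {A : Matrix (Fin s) (Fin s) ℝ} (hA : A.IsHermitian) :
    (A.charpoly.roots.filter (· ≠ 0)).card = A.rank := by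
  rw [hA.rank_eq_card_non_zero_eigs, hA.roots_charpoly_eq_eigenvalues, Multiset.filter_map,
    Multiset.card_map, Fintype.card_subtype]
  rfl

/-! ### Graphs covered by a root set -/

section Covering

variable {V : Type*}

/-- `S` covers `H` if every component of `H` meets `S`, that is, from every vertex some vertex of
`S` can be reached. -/
def Covers (H : SimpleGraph V) (S : Finset V) : Prop := ∀ x, ∃ u ∈ S, H.Reachable x u

/-- Every vertex outside `S` has a neighbour `p x` nearer to `S`, where the height
`d` is realised by the distance to `S`. -/
theorem Covers.exists_parent {H : SimpleGraph V} {S : Finset V} (h : Covers H S) :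
    ∃ (d : V → ℕ) (p : V → V), ∀ x ∉ S, H.Adj x (p x) ∧ d (p x) < d x := by
  classical
  have hex : ∀ x, ∃ n, ∃ u ∈ S, ∃ q : H.Walk x u, q.length = n := by
    intro x
    obtain ⟨u, hu, ⟨q⟩⟩ := h x
    exact ⟨_, u, hu, q, rfl⟩
  have key : ∀ x, ∃ y, x ∉ S → H.Adj x y ∧ Nat.find (hex y) < Nat.find (hex x) := by
    intro x
    obtain ⟨u, hu, q, hq⟩ := Nat.find_spec (hex x)
    cases q with
    | nil => exact ⟨x, fun hx => absurd hu hx⟩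
    | @cons _ y _ hadj q =>
      refine ⟨y, fun _ => ⟨hadj, ?_⟩⟩
      rw [← hq, SimpleGraph.Walk.length_cons, Nat.lt_succ_iff]
      exact Nat.find_min' _ ⟨u, hu, q, rfl⟩
  choose p hp using key
  exact ⟨fun x => Nat.find (hex x), p, hp⟩

/-- The edges from vertices to their parents are distinct: the vertex is the higher end. -/
theorem parent_edge_inj {d : V → ℕ} {p : V → V} {x y : V} (hx : d (p x) < d x)
    (hy : d (p y) < d y) (h : s(x, p x) = s(y, p y)) : x = y := by
  rcases Sym2.eq_iff.1 h with ⟨h, -⟩ | ⟨h1, h2⟩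
  · exact h
  · rw [h2] at hx; rw [← h1] at hy; omega

theorem edgeSet_edgeSubgraph {X : Finset (Sym2 V)} (hX : ∀ e ∈ X, ¬ e.IsDiag) :
    (edgeSubgraph X).edgeSet = X := by
  rw [edgeSubgraph, SimpleGraph.edgeSet_fromEdgeSet]
  ext e
  simpa using hX e

variable [Fintype V] [DecidableEq V]

/-- The edges from non-roots to their parents give `|V| - |S|` distinct edges. -/
theorem Covers.card_le {H : SimpleGraph V} {S : Finset V} (h : Covers H S)
    {X : Finset (Sym2 V)} (hX : H.edgeSet = X) : Fintype.card V ≤ S.card + X.card := by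
  obtain ⟨d, p, hp⟩ := h.exists_parent
  have : Sᶜ.card ≤ X.card := by
    refine Finset.card_le_card_of_injOn (fun x => s(x, p x)) (fun x hx => ?_) ?_
    · rw [← hX]; exact (hp x (by simpa using hx)).1
    · intro x hx y hy hxy
      exact parent_edge_inj (hp x (by simpa using hx)).2 (hp y (by simpa using hy)).2 hxy
  have := S.card_add_card_compl
  omega

/-- If `S` covers `H` with the least possible number of edges, every edge is a bridge: after deleting
a non-bridge, `S` would still cover, with too few edges. -/
theorem Covers.isAcyclic {H : SimpleGraph V} {S : Finset V} (h : Covers H S)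
    {X : Finset (Sym2 V)} (hX : H.edgeSet = X) (hc : S.card + X.card = Fintype.card V) :
    H.IsAcyclic := by
  rw [SimpleGraph.isAcyclic_iff_forall_adj_isBridge]
  intro a b hab
  rw [SimpleGraph.isBridge_iff]
  intro hr
  have hreach : ∀ x y, H.Reachable x y → (H.deleteEdges {s(a, b)}).Reachable x y := by
    rintro x y ⟨q⟩
    induction q with
    | nil => exact .rfl
    | @cons x z y hadj q ih =>
      refine SimpleGraph.Reachable.trans ?_ ih
      by_cases he : s(x, z) = s(a, b)
      · rcases Sym2.eq_iff.1 he with ⟨rfl, rfl⟩ | ⟨rfl, rfl⟩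
        · exact hr
        · exact hr.symm
      · exact SimpleGraph.Adj.reachable (by simpa [SimpleGraph.deleteEdges_adj, hadj] using he)
  have hcov : Covers (H.deleteEdges {s(a, b)}) S := fun x => by
    obtain ⟨u, hu, hxu⟩ := h x
    exact ⟨u, hu, hreach _ _ hxu⟩
  have hmem : s(a, b) ∈ X := by rw [← Finset.mem_coe, ← hX]; exact hab
  have := hcov.card_le (X := X.erase s(a, b))
    (by rw [SimpleGraph.edgeSet_deleteEdges, hX, Finset.coe_erase])
  rw [Finset.card_erase_of_mem hmem] at this
  have := Finset.card_pos.2 ⟨_, hmem⟩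
  omega

/-- If `S` covers `H` with the least possible number of edges, no component contains two vertices of
`S`: after removing one of them, `S` would still cover, with too few roots. -/
theorem Covers.root_unique {H : SimpleGraph V} {S : Finset V} (h : Covers H S)
    {X : Finset (Sym2 V)} (hX : H.edgeSet = X) (hc : S.card + X.card = Fintype.card V)
    {u u' : V} (hu : u ∈ S) (hu' : u' ∈ S) (huu : H.Reachable u u') : u = u' := by
  by_contra hne
  have hcov : Covers H (S.erase u) := fun x => by
    obtain ⟨y, hy, hxy⟩ := h x
    by_cases hyu : y = u
    · subst hyu
      exact ⟨u', Finset.mem_erase.2 ⟨Ne.symm hne, hu'⟩, hxy.trans huu⟩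
    · exact ⟨y, Finset.mem_erase.2 ⟨hyu, hy⟩, hxy⟩
  have := hcov.card_le hX
  rw [Finset.card_erase_of_mem hu] at this
  have := Finset.card_pos.2 ⟨_, hu⟩
  omega

/-- With `|V| - |S|` edges, the conditions that define a spanning forest rooted at `S` reduce to
the single condition that every component meets `S`. -/
theorem covers_iff_forest {H : SimpleGraph V} {S : Finset V}
    {X : Finset (Sym2 V)} (hX : H.edgeSet = X) (hc : S.card + X.card = Fintype.card V) :
    (H.IsAcyclic ∧ ∀ c : H.ConnectedComponent, ∃! u, u ∈ S ∧ u ∈ c.supp) ↔ Covers H S := by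
  constructor
  · rintro ⟨-, h⟩ x
    obtain ⟨u, ⟨hu, hux⟩, -⟩ := h (H.connectedComponentMk x)
    exact ⟨u, hu, (SimpleGraph.ConnectedComponent.exact hux).symm⟩
  · intro h
    refine ⟨h.isAcyclic hX hc, fun c => ?_⟩
    induction c using SimpleGraph.ConnectedComponent.ind with
    | h x =>
      obtain ⟨u, hu, hxu⟩ := h x
      refine ⟨u, ⟨hu, SimpleGraph.ConnectedComponent.sound hxu.symm⟩, ?_⟩
      rintro y ⟨hy, hyx⟩
      exact h.root_unique hX hc hy hu ((SimpleGraph.ConnectedComponent.exact hyx).trans hxu)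

/-- In a forest rooted at `S` every vertex outside `S` is the tail of exactly one arc, and no root is
the tail of an arc. -/
theorem Covers.forestWeight_eq {S : Finset V} {X : Finset (Sym2 V)}
    (hX : ∀ e ∈ X, ¬ e.IsDiag) (hc : S.card + X.card = Fintype.card V)
    (h : Covers (edgeSubgraph X) S) (α : V → ℝ) :
    forestWeight α X S = ∏ i ∈ Sᶜ, α i := by
  classical
  have hE := edgeSet_edgeSubgraph hX
  set H := edgeSubgraph X with hH
  have mem : ∀ a : V × V, a ∈ rootedArcs X S ↔ H.Adj a.1 a.2 ∧
      ∃ u ∈ S, H.Reachable a.1 u ∧ H.dist a.2 u < H.dist a.1 u := by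
    intro a; simp [rootedArcs, ← hH]
  have hmaps : ∀ a ∈ rootedArcs X S, a.1 ∈ Sᶜ := by
    intro a ha
    obtain ⟨-, u, hu, hr, hd⟩ := (mem a).1 ha
    rw [Finset.mem_compl]
    intro ha1
    have := h.root_unique hE hc ha1 hu hr
    rw [this, SimpleGraph.dist_self] at hd
    omega
  have hsurj : Set.SurjOn Prod.fst (rootedArcs X S : Set (V × V)) (Sᶜ : Finset V) := by
    intro x hx
    have hx' : x ∉ S := by simpa using hx
    obtain ⟨u, hu, hr⟩ := h x
    obtain ⟨q, hq⟩ := hr.exists_walk_length_eq_dist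
    cases q with
    | nil => exact absurd hu hx'
    | @cons _ y _ hadj q =>
      refine ⟨(x, y), (mem _).2 ⟨hadj, u, hu, hr, ?_⟩, rfl⟩
      have := SimpleGraph.dist_le q
      rw [SimpleGraph.Walk.length_cons] at hq
      change H.dist y u < H.dist x u
      omega
  -- each edge carries at most one arc, and there are as many edges as non-root vertices
  have hcard : (rootedArcs X S).card ≤ Sᶜ.card := by
    have hle : (rootedArcs X S).card ≤ X.card := by
      refine Finset.card_le_card_of_injOn (fun a => s(a.1, a.2)) (fun a ha => ?_) ?_
      · rw [← hE]; exact ((mem a).1 ha).1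
      · rintro ⟨a, b⟩ hab ⟨a', b'⟩ hab' heq
        rcases Sym2.eq_iff.1 heq with ⟨h1, h2⟩ | ⟨h1, h2⟩
        · exact Prod.ext h1 h2
        · obtain ⟨hadj, u, hu, hr, hd⟩ := (mem _).1 hab
          obtain ⟨hadj', u', hu', hr', hd'⟩ := (mem _).1 hab'
          dsimp only at *
          subst h1 h2
          have := h.root_unique hE hc hu hu' (hr.symm.trans (hadj.reachable.trans hr'))
          subst this
          omega
    have := S.card_add_card_compl
    omega
  have hinj := Finset.injOn_of_surjOn_of_card_le Prod.fst hmaps hsurj hcard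
  exact Finset.prod_nbij Prod.fst hmaps hinj hsurj fun _ _ => rfl

end Covering

/-! ### Minors of the incidence matrix -/

section Incidence
variable {v s : ℕ} {Q : Matrix (Fin v) (Fin s) ℝ} {j i : Fin s → Fin v}

theorem comparison_entry_sq {a b x : Fin v} (hab : a ≠ b) (hx : x = a ∨ x = b) :
    comparison a b x ^ 2 = 1 := by
  rcases hx with rfl | rfl
  · simp [comparison, hab]
  · simp [comparison, hab.symm]

theorem comparison_entry_ne_zero {a b x : Fin v} (h : comparison a b x ≠ 0) : x = a ∨ x = b := by
  by_contra! hx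
  exact h (by simp [comparison, hx.1, hx.2])

/-- If every component of the chosen edges meets `S`, matching each non-root with the edge to its
parent makes the incidence matrix with the rows of `S` deleted triangular, with entries `±1` on the
diagonal. -/
theorem minor_sq_eq_one (hne : ∀ k, j k ≠ i k) (hcol : ∀ k, Q.col k = comparison (j k) (i k))
    {S : Finset (Fin v)} {T : Finset (Fin s)} (hT : S.card + T.card = v)
    (h : Covers (edgeSubgraph (T.image fun k => s(j k, i k))) S) :
    ((Q.submatrix (Subtype.val : ↥Sᶜ → Fin v) (Subtype.val : T → Fin s))ᵀ *
      Q.submatrix (Subtype.val : ↥Sᶜ → Fin v) (Subtype.val : T → Fin s)).det = 1 := by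
  obtain ⟨d, p, hp⟩ := h.exists_parent
  have hq : ∀ x : ↥Sᶜ, ∃ k : T, s(j k, i k) = s(x.1, p x) := by
    intro x
    have := (hp x (Finset.mem_compl.1 x.2)).1
    rw [edgeSubgraph, SimpleGraph.fromEdgeSet_adj] at this
    obtain ⟨k, hk, hk'⟩ := Finset.mem_image.1 this.1
    exact ⟨⟨k, hk⟩, hk'⟩
  choose q hq using hq
  have hd : ∀ x : ↥Sᶜ, d (p x) < d x := fun x => (hp x (Finset.mem_compl.1 x.2)).2
  have hinj : Function.Injective q := by
    intro x y hxy
    refine Subtype.ext (parent_edge_inj (hd x) (hd y) ?_)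
    rw [← hq, ← hq, hxy]
  have hcard : Fintype.card ↥Sᶜ = Fintype.card T := by
    have := S.card_add_card_compl
    simp only [Fintype.card_coe, Fintype.card_fin] at *
    omega
  have hbij : Function.Bijective q := (Fintype.bijective_iff_injective_and_card q).2 ⟨hinj, hcard⟩
  have hent : ∀ (x : Fin v) k, Q x k = comparison (j k) (i k) x := fun x k =>
    congrFun (hcol k) x
  rw [det_transpose_mul_self_eq_sq _ (Equiv.ofBijective q hbij),
    det_eq_prod_diag_of_rank _ (fun x : ↥Sᶜ => d x), ← Finset.prod_pow]
  · refine Finset.prod_eq_one fun x _ => ?_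
    change Q x (q x) ^ 2 = 1
    rw [hent]
    refine comparison_entry_sq (hne _) ?_
    exact Sym2.mem_iff.1 (hq x ▸ Sym2.mem_mk_left _ _)
  · intro x y hxy
    change Q x (q y) ≠ 0 at hxy
    rw [hent] at hxy
    have : x.1 ∈ s(y.1, p y) := hq y ▸ Sym2.mem_iff.2 (comparison_entry_ne_zero hxy)
    rcases Sym2.mem_iff.1 this with h1 | h1
    · exact Or.inl (Subtype.ext h1)
    · right; rw [h1]; exact hd y

/-- If some component of the chosen edges misses `S`, its indicator vector is supported off `S` and
annihilates the incidence matrix with the rows of `S` deleted. -/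
theorem minor_sq_eq_zero (hne : ∀ k, j k ≠ i k) (hcol : ∀ k, Q.col k = comparison (j k) (i k))
    {S : Finset (Fin v)} {T : Finset (Fin s)} (hT : S.card + T.card = v)
    (h : ¬ Covers (edgeSubgraph (T.image fun k => s(j k, i k))) S) :
    ((Q.submatrix (Subtype.val : ↥Sᶜ → Fin v) (Subtype.val : T → Fin s))ᵀ *
      Q.submatrix (Subtype.val : ↥Sᶜ → Fin v) (Subtype.val : T → Fin s)).det = 0 := by
  classical
  set H := edgeSubgraph (T.image fun k => s(j k, i k)) with hH
  obtain ⟨x, hx⟩ : ∃ x, ∀ u ∈ S, ¬ H.Reachable x u := by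
    simpa [Covers] using h
  have hcard : Fintype.card ↥Sᶜ = Fintype.card T := by
    have := S.card_add_card_compl
    simp only [Fintype.card_coe, Fintype.card_fin] at *
    omega
  rw [det_transpose_mul_self_eq_sq _ (Fintype.equivOfCardEq hcard), sq_eq_zero_iff,
    ← Matrix.exists_vecMul_eq_zero_iff]
  let f : Fin v → ℝ := fun y => if H.Reachable x y then 1 else 0
  have hxS : x ∈ Sᶜ := Finset.mem_compl.2 fun hxS => hx x hxS .rfl
  refine ⟨fun y => f y, fun h0 => ?_, ?_⟩
  · have : f x = 0 := congrFun h0 ⟨x, hxS⟩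
    simp [f] at this
  · ext y
    set k := Fintype.equivOfCardEq hcard y
    change ∑ z : ↥Sᶜ, f z * Q z k = 0
    rw [Finset.sum_coe_sort Sᶜ (fun z => f z * Q z k),
      Finset.sum_subset (Finset.subset_univ _) fun z _ hz => ?_]
    · have hadj : H.Adj (j k) (i k) := by
        rw [hH, edgeSubgraph, SimpleGraph.fromEdgeSet_adj]
        exact ⟨Finset.mem_image_of_mem (fun k => s(j k, i k)) k.2, hne k⟩
      have hf : f (j k) = f (i k) := by
        have : H.Reachable x (j k) ↔ H.Reachable x (i k) :=
          ⟨fun hr => hr.trans hadj.reachable, fun hr => hr.trans hadj.symm.reachable⟩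
        simp only [f, this]
      have hent : ∀ z, Q z k = comparison (j k) (i k) z := fun z => congrFun (hcol k) z
      simp only [hent, comparison, Pi.sub_apply, mul_sub, Finset.sum_sub_distrib]
      simp [Pi.single_apply, hf]
    · have : f z = 0 := if_neg (hx z (by simpa using hz))
      rw [this, zero_mul]

theorem edgeFinset_contrastGraph
    (hne : ∀ k, j k ≠ i k) (hcol : ∀ k, Q.col k = comparison (j k) (i k))
    [Fintype (contrastGraph Q).toSimpleGraphInclusive.edgeSet] :
    (contrastGraph Q).toSimpleGraphInclusive.edgeFinset =
      Finset.univ.image fun k => s(j k, i k) := by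
  have inj : ∀ {a b c d : Fin v}, c ≠ d → comparison a b = comparison c d → s(c, d) = s(a, b) := by
    intro a b c d hcd h
    have h1 : comparison c d c = 1 := by simp [comparison, hcd]
    have h2 : comparison c d d = -1 := by simp [comparison, hcd.symm]
    rw [← h] at h1 h2
    have hc : c = a := by
      by_contra hca
      by_cases hcb : c = b <;> norm_num [comparison, hca, hcb] at h1
      · subst hcb; simp [hca] at h1; norm_num at h1
    have hd : d = b := by
      by_contra hdb
      by_cases hda : d = a
      · subst hda; simp [comparison, hdb] at h2; norm_num at h2
      · simp [comparison, hdb, hda] at h2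
    rw [hc, hd]
  ext e
  induction e with
  | h a b =>
    rw [SimpleGraph.mem_edgeFinset, SimpleGraph.mem_edgeSet, Digraph.toSimpleGraphInclusive,
      SimpleGraph.fromRel_adj]
    simp only [contrastGraph, Finset.mem_image, Finset.mem_univ, true_and]
    constructor
    · rintro ⟨-, ⟨k, hk⟩ | ⟨k, hk⟩⟩
      · exact ⟨k, inj (hne k) (hk.symm.trans (hcol k))⟩
      · exact ⟨k, (inj (hne k) (hk.symm.trans (hcol k))).trans Sym2.eq_swap⟩
    · rintro ⟨k, hk⟩
      rcases Sym2.eq_iff.1 hk with ⟨rfl, rfl⟩ | ⟨rfl, rfl⟩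
      · exact ⟨hne k, Or.inl ⟨k, hcol k⟩⟩
      · exact ⟨(hne k).symm, Or.inr ⟨k, hcol k⟩⟩

theorem kappaRoots_eq_sum (hne : ∀ k, j k ≠ i k)
    (hcol : ∀ k, Q.col k = comparison (j k) (i k))
    (hinj : Function.Injective fun k => s(j k, i k)) (α : Fin v → ℝ)
    {S : Finset (Fin v)} {r : ℕ} (hS : S.card + r = v) :
    kappaRoots (contrastGraph Q) α S =
      (∏ x ∈ Sᶜ, α x) * ∑ T ∈ Finset.univ.powersetCard r,
        ((Q.submatrix (Subtype.val : ↥Sᶜ → Fin v) (Subtype.val : T → Fin s))ᵀ *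
          Q.submatrix (Subtype.val : ↥Sᶜ → Fin v) (Subtype.val : T → Fin s)).det := by
  classical
  have hr : Fintype.card (Fin v) - S.card = r := by rw [Fintype.card_fin]; omega
  let f : Fin s ↪ Sym2 (Fin v) := ⟨_, hinj⟩
  have hmap : (Finset.univ.image fun k => s(j k, i k)) = Finset.univ.map f :=
    (Finset.map_eq_image f _).symm
  rw [kappaRoots, forestsWithRoots, Finset.sum_filter, hr, edgeFinset_contrastGraph hne hcol,
    hmap, Finset.powersetCard_map, Finset.sum_map, Finset.mul_sum]
  refine Finset.sum_congr rfl fun T hT => ?_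
  have hTc : T.card = r := (Finset.mem_powersetCard.1 hT).2
  have himg : (Finset.mapEmbedding f).toEmbedding T = T.image fun k => s(j k, i k) :=
    Finset.map_eq_image f T
  rw [himg]
  have hdiag : ∀ e ∈ T.image fun k => s(j k, i k), ¬ e.IsDiag := by
    intro e he
    obtain ⟨k, -, rfl⟩ := Finset.mem_image.1 he
    exact hne k
  have hXc : S.card + (T.image fun k => s(j k, i k)).card = Fintype.card (Fin v) := by
    rw [Finset.card_image_of_injective _ hinj, hTc, Fintype.card_fin, hS]
  simp only [covers_iff_forest (edgeSet_edgeSubgraph hdiag) hXc]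
  split_ifs with h
  · rw [minor_sq_eq_one hne hcol (by rw [hTc, hS]) h, mul_one, h.forestWeight_eq hdiag hXc]
  · rw [minor_sq_eq_zero hne hcol (by rw [hTc, hS]) h, mul_zero]

/-- The all-minors matrix-tree theorem, summed over all root sets of size `v - r`. -/
theorem kappa_eq_sum_minors (hQ : IsPairwiseComparisons Q) (α : Fin v → ℝ) {r : ℕ} (hr : r ≤ v) :
    kappa (contrastGraph Q) α (v - r) = ∑ T ∈ Finset.univ.powersetCard r,
      ((Qᵀ * Matrix.diagonal α * Q).submatrix
        (Subtype.val : T → Fin s) (Subtype.val : T → Fin s)).det := by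
  choose j i hne hcol using hQ.1
  have hinj : Function.Injective fun k => s(j k, i k) := by
    intro k l hkl
    by_contra hne'
    obtain ⟨h1, h2⟩ := hQ.2 k l hne'
    rcases Sym2.eq_iff.1 hkl with ⟨e1, e2⟩ | ⟨e1, e2⟩
    · exact h1 (by rw [hcol, hcol, e1, e2])
    · exact h2 (by rw [hcol, hcol, e1, e2, comparison, comparison, neg_sub])
  rw [sum_minors_gram, kappa]
  refine Finset.sum_bij' (fun S _ => Sᶜ) (fun R _ => Rᶜ) ?_ ?_ ?_ ?_ ?_
  · intro S hS
    have := (Finset.mem_powersetCard.1 hS).2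
    simp [Finset.mem_powersetCard, Finset.card_compl]
    omega
  · intro R hR
    have := (Finset.mem_powersetCard.1 hR).2
    simp [Finset.mem_powersetCard, Finset.card_compl, this]
  · simp
  · simp
  · intro S hS
    have := (Finset.mem_powersetCard.1 hS).2
    exact kappaRoots_eq_sum hne hcol hinj α (by omega)

end Incidence

/-! ### The spectra of the variance and information matrices -/

section Spectrum
variable {v s : ℕ} {Q : Matrix (Fin v) (Fin s) ℝ} {w : Fin v → ℝ}

/-- A feasible design gives positive weight to every treatment that occurs in some comparison. -/
theorem IsFeasible.pos (hrow : ∀ i, ∃ k, Q i k ≠ 0) (hw : IsDesign w) (h : IsFeasible Q w)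
    (i : Fin v) : 0 < w i := by
  obtain ⟨k, hk⟩ := hrow i
  refine lt_of_le_of_ne (hw.1 i).1 fun h0 => hk ?_
  obtain ⟨x, hx⟩ := h ⟨Pi.single k 1, rfl⟩
  have := congrFun hx i
  simpa [momentMatrix, Matrix.mulVec_diagonal, ← h0] using this.symm

theorem varianceMatrix_eq (hw : ∀ i, 0 < w i) :
    varianceMatrix Q w = Qᵀ * Matrix.diagonal (fun i => (w i)⁻¹) * Q := by
  rw [varianceMatrix, momentMatrix]
  congr 2
  refine Matrix.inv_eq_right_inv ?_
  rw [Matrix.diagonal_mul_diagonal, ← Matrix.diagonal_one]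
  congr 1
  ext i
  exact mul_inv_cancel₀ (hw i).ne'

theorem varianceMatrix_eq_gram (hw : ∀ i, 0 < w i) :
    varianceMatrix Q w = (Matrix.diagonal (fun i => √(w i)⁻¹) * Q)ᵀ *
      (Matrix.diagonal (fun i => √(w i)⁻¹) * Q) := by
  rw [varianceMatrix_eq hw, Matrix.transpose_mul, Matrix.diagonal_transpose, Matrix.mul_assoc,
    Matrix.mul_assoc, ← Matrix.mul_assoc (Matrix.diagonal _) (Matrix.diagonal _),
    Matrix.diagonal_mul_diagonal]
  congr 4
  ext i
  exact (Real.mul_self_sqrt (inv_nonneg.2 (hw i).le)).symm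

theorem rank_varianceMatrix (hw : ∀ i, 0 < w i) : (varianceMatrix Q w).rank = Q.rank := by
  rw [varianceMatrix_eq_gram hw, Matrix.rank_transpose_mul_self]
  refine Matrix.rank_mul_eq_right_of_isUnit_det _ _ ?_
  rw [Matrix.det_diagonal, isUnit_iff_ne_zero, Finset.prod_ne_zero_iff]
  exact fun i _ => (Real.sqrt_pos.2 (inv_pos.2 (hw i))).ne'

theorem roots_varianceMatrix_nonneg (hw : ∀ i, 0 < w i) {x : ℝ}
    (hx : x ∈ (varianceMatrix Q w).charpoly.roots) : 0 ≤ x := by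
  have hpsd : (varianceMatrix Q w).PosSemidef := by
    rw [varianceMatrix_eq_gram hw, ← Matrix.conjTranspose_eq_transpose_of_trivial]
    exact Matrix.posSemidef_conjTranspose_mul_self _
  rw [hpsd.isHermitian.roots_charpoly_eq_eigenvalues] at hx
  obtain ⟨k, -, rfl⟩ := Multiset.mem_map.1 hx
  exact hpsd.eigenvalues_nonneg k

/-- Both branches in the definition of the information matrix yield the Moore-Penrose inverse. -/
theorem isMoorePenrose_informationMatrix (hw : ∀ i, 0 < w i) :
    IsMoorePenrose (varianceMatrix Q w) (informationMatrix Q w) := by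
  unfold informationMatrix
  split_ifs with h
  · have hu : IsUnit (varianceMatrix Q w).det := by
      rw [← Matrix.isUnit_iff_isUnit_det, ← Matrix.mulVec_surjective_iff_isUnit]
      have htop : LinearMap.range (varianceMatrix Q w).mulVecLin = ⊤ := by
        refine Submodule.eq_top_of_finrank_eq ?_
        rw [← Matrix.rank, rank_varianceMatrix hw, h, Module.finrank_fin_fun]
      exact LinearMap.range_eq_top.1 htop
    refine ⟨?_, ?_, ?_, ?_⟩
    · rw [Matrix.mul_nonsing_inv _ hu, Matrix.one_mul]
    · rw [Matrix.nonsing_inv_mul _ hu, Matrix.one_mul]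
    · rw [Matrix.mul_nonsing_inv _ hu]; exact Matrix.isHermitian_one
    · rw [Matrix.nonsing_inv_mul _ hu]; exact Matrix.isHermitian_one
  · exact pinv_spec (varianceMatrix_isHermitian Q w)

theorem psiZero_eq_prod_roots (hw : ∀ i, 0 < w i) :
    psiZero Q w = ((varianceMatrix Q w).charpoly.roots.filter (· ≠ 0)).prod := by
  rw [← eigenvalueProd_eq_prod_roots (varianceMatrix_isHermitian Q w)
    (fun x => roots_varianceMatrix_nonneg hw),
    card_nonzero_roots (varianceMatrix_isHermitian Q w), rank_varianceMatrix hw, psiZero]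

theorem psiZero_pos (hw : ∀ i, 0 < w i) : 0 < psiZero Q w := by
  rw [psiZero_eq_prod_roots hw]
  refine Multiset.prod_pos fun x hx => ?_
  obtain ⟨h1, h2⟩ := Multiset.mem_filter.1 hx
  exact lt_of_le_of_ne (roots_varianceMatrix_nonneg hw h1) h2.symm

theorem informationProd_eq_inv (hw : ∀ i, 0 < w i) :
    informationProd Q w = (psiZero Q w)⁻¹ := by
  have hroots := (isMoorePenrose_informationMatrix hw).roots_charpoly
    (varianceMatrix_isHermitian Q w)
  have hfilter : (informationMatrix Q w).charpoly.roots.filter (· ≠ 0) =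
      ((varianceMatrix Q w).charpoly.roots.filter (· ≠ 0)).map (·⁻¹) := by
    rw [hroots, Multiset.filter_map]
    congr 1
    exact Multiset.filter_congr fun x _ => by simp
  have h0 : ∀ x ∈ (informationMatrix Q w).charpoly.roots, 0 ≤ x := by
    intro x hx
    rw [hroots] at hx
    obtain ⟨y, hy, rfl⟩ := Multiset.mem_map.1 hx
    exact inv_nonneg.2 (roots_varianceMatrix_nonneg hw hy)
  have h := eigenvalueProd_eq_prod_roots (informationMatrix_isHermitian Q w) h0
  rw [hfilter, Multiset.card_map, card_nonzero_roots (varianceMatrix_isHermitian Q w),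
    rank_varianceMatrix hw, Multiset.prod_map_inv, Multiset.map_id',
    ← psiZero_eq_prod_roots hw] at h
  exact h

theorem psiZero_eq_kappa (hQ : IsPairwiseComparisons Q) (hw : ∀ i, 0 < w i) :
    psiZero Q w = kappa (contrastGraph Q) (fun i => (w i)⁻¹) (v - Q.rank) := by
  have hle : Q.rank ≤ v := by simpa using Q.rank_le_card_height
  rw [kappa_eq_sum_minors hQ _ hle, ← varianceMatrix_eq hw, psiZero_eq_prod_roots hw]
  refine prod_nonzero_roots_eq_sum_minors (varianceMatrix_isHermitian Q w) ?_
  rw [card_nonzero_roots (varianceMatrix_isHermitian Q w), rank_varianceMatrix hw]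

end Spectrum

end TreatmentDesign

theorem proposition2 {v s r : ℕ} (Q : Matrix (Fin v) (Fin s) ℝ)
    (hQ : TreatmentDesign.IsPairwiseComparisons Q)
    (hrow : ∀ i, ∃ k, Q i k ≠ 0)
    (hr : Q.rank = r)
    (w : Fin v → ℝ)
    (hw : TreatmentDesign.IsDesign w)
    (hfeas : TreatmentDesign.IsFeasible Q w) :
    0 < TreatmentDesign.kappa (TreatmentDesign.contrastGraph Q) (fun i => (w i)⁻¹) (v - r) ∧
    TreatmentDesign.psiZero Q w =
      TreatmentDesign.kappa (TreatmentDesign.contrastGraph Q) (fun i => (w i)⁻¹) (v - r) ∧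
    TreatmentDesign.informationProd Q w =
      1 / TreatmentDesign.kappa (TreatmentDesign.contrastGraph Q) (fun i => (w i)⁻¹) (v - r) ∧
    TreatmentDesign.phiZero Q w =
      (1 / TreatmentDesign.kappa (TreatmentDesign.contrastGraph Q) (fun i => (w i)⁻¹) (v - r)) ^
        (1 / (r : ℝ)) := by
  subst hr
  have hpos := hfeas.pos hrow hw
  rw [← TreatmentDesign.psiZero_eq_kappa hQ hpos, TreatmentDesign.phiZero,
    TreatmentDesign.informationProd_eq_inv hpos, one_div]
  exact ⟨TreatmentDesign.psiZero_pos hpos, rfl, rfl, rfl⟩
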